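/- Let $G$ be a finite simple undirected graph on $n$ vertices with minimum degree $\delta \ge 3$. Let $\mu_i$ denote the $i$-th smallest eigenvalue, counted with multiplicity, of the Laplacian matrix $L = D - A$ of $G$, where $D$ is the diagonal matrix of vertex degrees and $A$ is the adjacency matrix of $G$. If $(\delta-1)\mu_2 \ge \mu_n$, then $G$ has an even spanning subgraph, that is, a subgraph with the same vertex set as $G$ in which every vertex has positive even degree. -/

import Mathlib

/-- `μ i`, the `i`-th smallest eigenvalue (counted with multiplicity, `1 ≤ i ≤ n`) of the Laplacian
matrix of a graph with `n` vertices; outside that range of `i` the value `0` is a placeholder.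
Mathlib lists the eigenvalues of a Hermitian matrix in decreasing order as
`eigenvalues₀ 0 ≥ ⋯ ≥ eigenvalues₀ (n - 1)`, so the `i`-th smallest one has index `n - i`. -/
noncomputable def laplacianEigenvalue {V : Type*} [Fintype V] [DecidableEq V]
    (G : SimpleGraph V) [DecidableRel G.Adj] (i : ℕ) : ℝ :=
  if h : 1 ≤ i ∧ i ≤ Fintype.card V then
    (G.isHermitian_lapMatrix ℝ).eigenvalues₀ ⟨Fintype.card V - i, by omega⟩
  else 0

/-- A graph is even if the degree of each vertex is positive and even. -/
def IsEvenGraph {V : Type*} [Fintype V] (H : SimpleGraph V) [DecidableRel H.Adj] : Prop :=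
  ∀ v : V, 0 < H.degree v ∧ Even (H.degree v)

/-!
The eigenvalue condition rules out bridges, and a graph of minimum degree at least three without
bridges has an even spanning subgraph.

For the spectral part, suppose that a single edge leaves a set `C` of vertices. As all degrees are
at least three, `C` and its complement have at least two vertices each. Some nonzero vector that is
constant on `C` and on its complement is orthogonal to an eigenvector of `μ 1`, and its Rayleigh
quotient shows `μ 2 ≤ 1` (`SimpleGraph.laplacianEigenvalue_two_le_one`). On the other hand `μ n ≥ δ`
(`SimpleGraph.degree_le_laplacianEigenvalue_card`), so `(δ - 1) * μ 2 ≤ δ - 1 < μ n`.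

For the combinatorial part, the even spanning subgraphs of `G` with positive degrees come from the
perfect matchings of an auxiliary graph (`SimpleGraph.parityGadget`). Each vertex of degree `d` is
replaced by a clique of `d` ports, one for each incident edge, together with two nonadjacent
vertices joined to all the ports; the two ports of an edge are joined. In a perfect matching the
number of ports at a vertex that are not matched along their edges is even and at least two, so the
edges not used by the matching form the required subgraph
(`SimpleGraph.exists_isEvenGraph_of_isPerfectMatching`). A perfect matching exists by Tutte's
theorem, whose condition follows from a count of the deleted ports
(`SimpleGraph.two_mul_card_add_card_le`): parity, together with the absence of cuts of size one,
gives every odd component enough edges with a deleted end.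
-/

open Finset SimpleGraph

theorem Finset.even_card_of_involution {α : Type*} (s : Finset α) (g : α → α)
    (hmem : ∀ a ∈ s, g a ∈ s) (hne : ∀ a ∈ s, g a ≠ a) (hinv : ∀ a ∈ s, g (g a) = a) :
    Even #s := by
  rw [← ZMod.natCast_eq_zero_iff_even, card_eq_sum_ones, Nat.cast_sum]
  exact sum_involution (fun a _ => g a) (fun _ _ => by decide) (fun a ha _ => hne a ha)
    hmem hinv

namespace SimpleGraph

/-! ### Counting deleted vertices of the gadget graph -/

variable {V : Type*} (G : SimpleGraph V)

/-- The vertices of the parity gadget graph: one port for each dart of `G`, attached to the first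
vertex of the dart, and two extra vertices for each vertex of `G`. -/
abbrev GadgetVertex : Type _ := G.Dart ⊕ V × Bool

variable {G}

/-- The vertex of `G` to whose gadget a gadget vertex belongs. -/
def GadgetVertex.base : G.GadgetVertex → V :=
  Sum.elim (fun a => a.fst) Prod.fst

@[simp]
theorem GadgetVertex.base_inl (a : G.Dart) : base (.inl a : G.GadgetVertex) = a.fst := rfl

@[simp]
theorem GadgetVertex.base_inr (p : V × Bool) : base (.inr p : G.GadgetVertex) = p.1 := rfl

variable [Fintype V] [DecidableRel G.Adj]

/-- Each vertex has an even number of extra vertices, and the darts that stay inside a vertex class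
come in pairs of opposite ones, so only the darts leaving the class matter modulo two. -/
theorem card_filter_base_modEq {κ : Type*} [DecidableEq κ] (f : V → κ) (c : κ) :
    #{w : G.GadgetVertex | f w.base = c} ≡
      #{a : G.Dart | f a.fst = c ∧ f a.snd ≠ c} [MOD 2] := by
  have h1 : #{w : G.GadgetVertex | f w.base = c} =
      #{a : G.Dart | f a.fst = c} + 2 * #{v : V | f v = c} := by
    simp only [card_filter, Fintype.sum_sum_type, Fintype.sum_prod_type,
      GadgetVertex.base_inl, GadgetVertex.base_inr, Fintype.sum_bool, two_mul, sum_add_distrib]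
    rfl
  have h2 : #{a : G.Dart | f a.fst = c} = #{a : G.Dart | f a.fst = c ∧ f a.snd = c} +
      #{a : G.Dart | f a.fst = c ∧ f a.snd ≠ c} := by
    rw [← card_filter_add_card_filter_not (fun a : G.Dart => f a.snd = c), filter_filter,
      filter_filter]
  have h3 : Even #{a : G.Dart | f a.fst = c ∧ f a.snd = c} := by
    refine even_card_of_involution _ Dart.symm ?_ (fun a _ => a.symm_ne) fun a _ => a.symm_symm
    intro a
    simp only [mem_filter_univ]
    exact And.symm
  obtain ⟨k, hk⟩ := h3
  rw [h1, h2, hk, Nat.ModEq]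
  omega

variable [DecidableEq V]

variable (G) in
/-- No set of vertices is left by exactly one edge. The edges leaving `C` are counted as darts
from `C` to its complement. Equivalently, `G` has no bridge. -/
def NoSingleEdgeCut : Prop :=
  ∀ C : Finset V, #{a : G.Dart | a.fst ∈ C ∧ a.snd ∉ C} ≠ 1

/-- The inequality behind Tutte's condition for the gadget graph. Here `u` is a set of deleted
gadget vertices, `f` labels the vertices of `G` that keep a port by the component containing it
(the others are labelled `none`), and `B` is the set of labels of odd components.

For a label `c ∈ B` let `b` be the number of edges of `G` leaving the class of `c`, `s` the number
of gadget vertices deleted from the class, `t` the number of deleted ports among the near ends of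
the leaving edges, and `o` the number of deleted ports among their far ends. Every leaving edge has
a deleted end, so `b ≤ o + t`; parity and `b ≠ 1` then give `3 + t ≤ 3 * s + o`. In the sum over `c`
the terms `o` are absorbed by the terms `t` and by the deleted ports outside the classes in `B`,
of which there are at least three for each vertex labelled `none`. -/
theorem two_mul_card_add_card_le {ι : Type*} [DecidableEq ι]
    (hdeg : ∀ v, 3 ≤ G.degree v) (hcut : G.NoSingleEdgeCut)
    (u : Finset G.GadgetVertex) (f : V → Option ι) (B : Finset (Option ι)) (hB : none ∉ B)
    (hnone : ∀ a : G.Dart, f a.fst = none → Sum.inl a ∈ u)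
    (hadj : ∀ a : G.Dart, Sum.inl a ∉ u → Sum.inl a.symm ∉ u → f a.fst = f a.snd)
    (hodd : ∀ c ∈ B, Odd #{w : G.GadgetVertex | w ∉ u ∧ f w.base = c}) :
    2 * #{v | f v = none} + #B ≤ #u := by
  have key : ∀ c ∈ B, 3 + #{a : G.Dart | (Sum.inl a ∈ u ∧ f a.fst ≠ f a.snd) ∧ f a.fst = c} ≤
      3 * #{w ∈ u | f w.base = c} +
        #{a : G.Dart | (Sum.inl a.symm ∈ u ∧ f a.fst ≠ f a.snd) ∧ f a.fst = c} := by
    intro c hc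
    set t := #{a : G.Dart | (Sum.inl a ∈ u ∧ f a.fst ≠ f a.snd) ∧ f a.fst = c}
    set s := #{w ∈ u | f w.base = c}
    set o := #{a : G.Dart | (Sum.inl a.symm ∈ u ∧ f a.fst ≠ f a.snd) ∧ f a.fst = c}
    set b := #{a : G.Dart | f a.fst = c ∧ f a.snd ≠ c} with hb
    have hb1 : b ≠ 1 := by simpa [hb] using hcut {v | f v = c}
    have hts : t ≤ s := by
      refine card_le_card_of_injOn Sum.inl ?_ Sum.inl_injective.injOn
      intro a ha
      simp only [coe_filter, mem_univ, true_and, Set.mem_ofPred_eq] at ha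
      simpa using ⟨ha.1.1, ha.2⟩
    have htb : t ≤ b := by
      refine card_le_card fun a => ?_
      simp only [mem_filter_univ]
      rintro ⟨⟨_, h⟩, rfl⟩
      exact ⟨rfl, h.symm⟩
    have hbot : b ≤ o + t := by
      refine (card_le_card fun a => ?_).trans (card_union_le _ _)
      simp only [mem_filter_univ, mem_union]
      rintro ⟨rfl, h⟩
      by_cases ha : Sum.inl a ∈ u
      · exact Or.inr ⟨⟨ha, h.symm⟩, rfl⟩
      · refine Or.inl ⟨⟨?_, h.symm⟩, rfl⟩
        by_contra ha'
        exact h (hadj a ha ha').symm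
    have hpar := card_filter_base_modEq (G := G) f c
    have hsplit : #{w : G.GadgetVertex | f w.base = c} =
        s + #{w : G.GadgetVertex | w ∉ u ∧ f w.base = c} := by
      rw [← card_filter_add_card_filter_not (fun w => w ∈ u), filter_filter, filter_filter]
      congr 2
      · ext w; simp [and_comm]
      · ext w; simp [and_comm]
    obtain ⟨k, hk⟩ := hodd c hc
    rw [hsplit, hk, ← hb, Nat.ModEq] at hpar
    omega
  have hfib (P : G.Dart → Prop) [DecidablePred P] :
      ∑ c ∈ B, #{a : G.Dart | P a ∧ f a.fst = c} = #{a : G.Dart | P a ∧ f a.fst ∈ B} := by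
    simp_rw [← filter_filter]
    exact sum_card_fiberwise_eq_card_filter _ _ _
  have hsum := sum_le_sum key
  rw [sum_add_distrib, sum_add_distrib, hfib, hfib, ← mul_sum, sum_const, smul_eq_mul,
    sum_card_fiberwise_eq_card_filter] at hsum
  -- Reversing darts turns the far ends of the leaving edges into near ends.
  have hrev : #{a : G.Dart | (Sum.inl a.symm ∈ u ∧ f a.fst ≠ f a.snd) ∧ f a.fst ∈ B} ≤
      #{a : G.Dart | (Sum.inl a ∈ u ∧ f a.fst ≠ f a.snd) ∧ f a.fst ∈ B} +
        #{a : G.Dart | Sum.inl a ∈ u ∧ f a.fst ∉ B} := by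
    refine le_trans ?_ (card_union_le _ _)
    refine card_le_card_of_injOn Dart.symm ?_ Dart.symm_involutive.injective.injOn
    intro a ha
    simp only [coe_filter, mem_univ, true_and, Set.mem_ofPred_eq] at ha
    obtain ⟨⟨h1, h2⟩, -⟩ := ha
    simp only [coe_union, coe_filter, mem_univ, true_and, Set.mem_union, Set.mem_ofPred_eq]
    by_cases h3 : f a.symm.fst ∈ B
    · exact Or.inl ⟨⟨h1, h2.symm⟩, h3⟩
    · exact Or.inr ⟨h1, h3⟩
  have hu : #{w ∈ u | f w.base ∈ B} + #{a : G.Dart | Sum.inl a ∈ u ∧ f a.fst ∉ B} ≤ #u := by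
    rw [← card_filter_add_card_filter_not (s := u) (fun w => f w.base ∈ B)]
    refine Nat.add_le_add_left (card_le_card_of_injOn Sum.inl ?_ Sum.inl_injective.injOn) _
    intro a ha
    simpa using ha
  have hT : 3 * #{v | f v = none} ≤ #{a : G.Dart | Sum.inl a ∈ u ∧ f a.fst ∉ B} := by
    rw [mul_comm, ← smul_eq_mul, ← sum_const]
    calc ∑ v with f v = none, 3
        ≤ ∑ v with f v = none, #{a : G.Dart | a.fst = v} := by
          refine sum_le_sum fun v _ => ?_
          rw [dart_fst_fiber_card_eq_degree]
          exact hdeg v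
      _ = #{a : G.Dart | a.fst ∈ ({v | f v = none} : Finset V)} :=
          sum_card_fiberwise_eq_card_filter _ _ _
      _ ≤ _ := by
          refine card_le_card fun a => ?_
          simp only [mem_filter_univ]
          exact fun h => ⟨hnone a h, h ▸ hB⟩
  omega

end SimpleGraph

/-! ### Rayleigh quotients and cuts -/

open Matrix in
theorem Matrix.IsHermitian.dotProduct_eq_sum_sq {n : Type*} [Fintype n] [DecidableEq n]
    {A : Matrix n n ℝ} (hA : A.IsHermitian) (x : n → ℝ) :
    x ⬝ᵥ x = ∑ i, (x ⬝ᵥ (hA.eigenvectorBasis i).ofLp) ^ 2 := by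
  have h := hA.eigenvectorBasis.sum_inner_mul_inner (WithLp.toLp 2 x) (WithLp.toLp 2 x)
  simp only [EuclideanSpace.inner_eq_star_dotProduct, star_trivial] at h
  rw [← h]
  refine sum_congr rfl fun i _ => ?_
  rw [dotProduct_comm x, sq]

open Matrix in
theorem Matrix.IsHermitian.dotProduct_mulVec_eq_sum {n : Type*} [Fintype n] [DecidableEq n]
    {A : Matrix n n ℝ} (hA : A.IsHermitian) (x : n → ℝ) :
    x ⬝ᵥ A *ᵥ x =
      ∑ i, hA.eigenvalues i * (x ⬝ᵥ (hA.eigenvectorBasis i).ofLp) ^ 2 := by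
  have h := hA.eigenvectorBasis.sum_inner_mul_inner (WithLp.toLp 2 x) (WithLp.toLp 2 (A *ᵥ x))
  simp only [EuclideanSpace.inner_eq_star_dotProduct, star_trivial] at h
  rw [dotProduct_comm, ← h]
  refine sum_congr rfl fun i _ => ?_
  have hs : Aᵀ = A := by rw [← conjTranspose_eq_transpose_of_trivial, hA.eq]
  have h1 : (A *ᵥ x) ⬝ᵥ (hA.eigenvectorBasis i).ofLp =
      x ⬝ᵥ (A *ᵥ (hA.eigenvectorBasis i).ofLp) := by
    rw [dotProduct_mulVec, ← mulVec_transpose, hs]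
  rw [h1, hA.mulVec_eigenvectorBasis, dotProduct_smul, dotProduct_comm _ x]
  rw [smul_eq_mul]
  ring

namespace SimpleGraph

variable {V : Type*} [Fintype V] [DecidableEq V] {G : SimpleGraph V} [DecidableRel G.Adj]

open Matrix in
theorem dotProduct_lapMatrix_mulVec (x : V → ℝ) :
    x ⬝ᵥ G.lapMatrix ℝ *ᵥ x = (∑ a : G.Dart, (x a.fst - x a.snd) ^ 2) / 2 := by
  have h := G.lapMatrix_toLinearMap₂' ℝ x
  rw [toLinearMap₂'_apply'] at h
  rw [h, ← Fintype.sum_prod_type', ← sum_filter]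
  congr 1
  symm
  refine sum_bij (fun a _ => a.toProd) ?_ ?_ ?_ ?_
  · intro a _; simp
  · intro a _ b _ h; exact Dart.ext _ _ h
  · intro p hp; exact ⟨⟨p, by simpa using hp⟩, mem_univ _, rfl⟩
  · intro a _; rfl

open Matrix in
/-- The largest Laplacian eigenvalue is at least every degree: the degree of `v` is the
Rayleigh quotient of the indicator of `v`. -/
theorem degree_le_laplacianEigenvalue_card (v : V) :
    (G.degree v : ℝ) ≤ laplacianEigenvalue G (Fintype.card V) := by
  have hn : 1 ≤ Fintype.card V := Fintype.card_pos_iff.mpr ⟨v⟩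
  have hA := G.isHermitian_lapMatrix ℝ
  have h1 := hA.dotProduct_eq_sum_sq (Pi.single v 1)
  have h2 := hA.dotProduct_mulVec_eq_sum (Pi.single v 1)
  have h3 : (Pi.single v 1 : V → ℝ) ⬝ᵥ G.lapMatrix ℝ *ᵥ (Pi.single v 1) = G.degree v := by
    rw [single_one_dotProduct, lapMatrix_mulVec_apply, Pi.single_eq_same, mul_one, sub_eq_self]
    refine sum_eq_zero fun w hw => Pi.single_eq_of_ne ?_ _
    rintro rfl
    simp at hw
  have h4 : (Pi.single v 1 : V → ℝ) ⬝ᵥ Pi.single v 1 = 1 := by simp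
  rw [← h3, h2]
  calc _ ≤ ∑ i, laplacianEigenvalue G (Fintype.card V) *
        ((Pi.single v 1 : V → ℝ) ⬝ᵥ (hA.eigenvectorBasis i).ofLp) ^ 2 := by
        refine sum_le_sum fun i _ => mul_le_mul_of_nonneg_right ?_ (sq_nonneg _)
        rw [laplacianEigenvalue, dif_pos ⟨hn, le_rfl⟩]
        refine hA.eigenvalues₀_antitone (Fin.le_def.mpr ?_)
        simp
    _ = _ := by rw [← mul_sum, ← h1, h4, mul_one]

open Matrix in
/-- A vector orthogonal to one suitable vector, namely an eigenvector for the smallest eigenvalue,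
has Rayleigh quotient at least `μ 2`. -/
theorem exists_laplacianEigenvalue_two_mul_le (hn : 2 ≤ Fintype.card V) :
    ∃ z : V → ℝ, ∀ x : V → ℝ, x ⬝ᵥ z = 0 →
      laplacianEigenvalue G 2 * (x ⬝ᵥ x) ≤ x ⬝ᵥ G.lapMatrix ℝ *ᵥ x := by
  have hA := G.isHermitian_lapMatrix ℝ
  let e := Fintype.equivOfCardEq (Fintype.card_fin (Fintype.card V)) (β := V)
  let i₀ : V := e ⟨Fintype.card V - 1, by omega⟩
  refine ⟨(hA.eigenvectorBasis i₀).ofLp, fun x hx => ?_⟩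
  rw [hA.dotProduct_eq_sum_sq x, hA.dotProduct_mulVec_eq_sum x, mul_sum]
  refine sum_le_sum fun i _ => ?_
  by_cases hi : i = i₀
  · rw [hi, hx]; simp
  · refine mul_le_mul_of_nonneg_right ?_ (sq_nonneg _)
    rw [laplacianEigenvalue, dif_pos ⟨by omega, hn⟩]
    refine hA.eigenvalues₀_antitone (Fin.le_def.mpr ?_)
    have h1 : (e.symm i : ℕ) ≠ Fintype.card V - 1 := by
      intro h
      apply hi
      rw [← e.apply_symm_apply i]
      exact congrArg e (Fin.ext h)
    have h2 := (e.symm i).isLt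
    change (e.symm i : ℕ) ≤ Fintype.card V - 2
    omega

theorem card_dart_leaving_compl (C : Finset V) :
    #{a : G.Dart | a.fst ∈ Cᶜ ∧ a.snd ∉ Cᶜ} = #{a : G.Dart | a.fst ∈ C ∧ a.snd ∉ C} := by
  refine card_bij (fun a _ => a.symm) ?_
    (fun a _ b _ h => Dart.symm_involutive.injective h) ?_
  · intro a; simp only [mem_filter_univ, mem_compl, not_not]; exact And.symm
  · intro a
    simp only [mem_filter_univ, mem_compl, not_not]
    exact fun h => ⟨a.symm, h.symm, a.symm_symm⟩

/-- A single edge leaving `C` forces `μ 2 ≤ 1` when both sides have at least two vertices. The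
test vector is a combination of the indicators of `C` and of its complement, chosen orthogonal
to a given vector. -/
theorem laplacianEigenvalue_two_le_one (C : Finset V) (h2 : 2 ≤ #C) (h2' : 2 ≤ #Cᶜ)
    (hcut : #{a : G.Dart | a.fst ∈ C ∧ a.snd ∉ C} = 1) : laplacianEigenvalue G 2 ≤ 1 := by
  have hcard := card_add_card_compl C
  obtain ⟨z, hz⟩ := exists_laplacianEigenvalue_two_mul_le (G := G) (by omega)
  obtain ⟨α, β, hαβ, hne⟩ : ∃ α β : ℝ, α * ∑ v ∈ C, z v + β * ∑ v ∈ Cᶜ, z v = 0 ∧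
      0 < α ^ 2 + β ^ 2 := by
    by_cases h : ∑ v ∈ C, z v = 0
    · exact ⟨1, 0, by simp [h], by norm_num⟩
    · exact ⟨-∑ v ∈ Cᶜ, z v, ∑ v ∈ C, z v, by ring, by positivity⟩
  let x : V → ℝ := fun v => if v ∈ C then α else β
  have hsum (g : V → ℝ → ℝ) :
      ∑ v, g v (x v) = ∑ v ∈ C, g v α + ∑ v ∈ Cᶜ, g v β := by
    rw [← sum_add_sum_compl C]
    refine congrArg₂ _ (sum_congr rfl fun v hv => ?_) (sum_congr rfl fun v hv => ?_)
    · simp [x, hv]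
    · simp [x, mem_compl.mp hv]
  have hx := hz x (by
    rw [dotProduct, hsum fun v t => t * z v, ← mul_sum, ← mul_sum, hαβ])
  have hxx : dotProduct x x = #C * α ^ 2 + #Cᶜ * β ^ 2 := by
    rw [dotProduct, hsum fun _ t => t * t]
    simp [sq]
  have hcut' : #{a : G.Dart | a.fst ∉ C ∧ a.snd ∈ C} = 1 := by
    rw [← hcut, ← card_dart_leaving_compl]
    simp
  have hq : ∑ a : G.Dart, (x a.fst - x a.snd) ^ 2 = 2 * (α - β) ^ 2 := by
    have : ∀ a : G.Dart, (x a.fst - x a.snd) ^ 2 =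
        (if a.fst ∈ C ∧ a.snd ∉ C then (α - β) ^ 2 else 0) +
          (if a.fst ∉ C ∧ a.snd ∈ C then (α - β) ^ 2 else 0) := by
      intro a
      by_cases h1 : a.fst ∈ C <;> by_cases h2 : a.snd ∈ C <;> simp [x, h1, h2]
      ring
    rw [sum_congr rfl fun a _ => this a, sum_add_distrib, ← sum_filter, ← sum_filter, sum_const,
      sum_const, hcut, hcut']
    ring
  rw [dotProduct_lapMatrix_mulVec, hq, hxx] at hx
  by_contra! hμ
  have h2C : (2 : ℝ) ≤ #C := by exact_mod_cast h2
  have h2C' : (2 : ℝ) ≤ #Cᶜ := by exact_mod_cast h2'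
  have h3 : 2 * (α ^ 2 + β ^ 2) ≤ #C * α ^ 2 + #Cᶜ * β ^ 2 := by
    nlinarith [mul_le_mul_of_nonneg_right h2C (sq_nonneg α),
      mul_le_mul_of_nonneg_right h2C' (sq_nonneg β)]
  nlinarith [sq_nonneg (α + β), mul_lt_mul_of_pos_right hμ (by linarith :
    0 < #C * α ^ 2 + #Cᶜ * β ^ 2)]

theorem card_dart_leaving_singleton (v : V) :
    #{a : G.Dart | a.fst ∈ ({v} : Finset V) ∧ a.snd ∉ ({v} : Finset V)} = G.degree v := by
  rw [← dart_fst_fiber_card_eq_degree]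
  congr 1
  ext a
  simp only [mem_filter_univ, mem_singleton, and_iff_left_iff_imp]
  rintro rfl
  exact a.adj.ne'

/-- The eigenvalue condition excludes bridges: a bridge would give `μ 2 ≤ 1`, whereas
`μ n ≥ δ`. -/
theorem noSingleEdgeCut_of_laplacianEigenvalue (hδ : 3 ≤ G.minDegree)
    (hμ : ((G.minDegree : ℝ) - 1) * laplacianEigenvalue G 2 ≥
      laplacianEigenvalue G (Fintype.card V)) : G.NoSingleEdgeCut := by
  intro C hcut
  have hdeg (v : V) : 3 ≤ G.degree v := hδ.trans (G.minDegree_le_degree v)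
  obtain ⟨a, ha⟩ := card_pos.mp (hcut ▸ one_pos)
  simp only [mem_filter_univ] at ha
  by_cases h2 : 2 ≤ #C
  · by_cases h2' : 2 ≤ #Cᶜ
    · have h1 := laplacianEigenvalue_two_le_one C h2 h2' hcut
      have h3 := degree_le_laplacianEigenvalue_card (G := G) a.fst
      have h4 : (G.minDegree : ℝ) ≤ G.degree a.fst := by exact_mod_cast G.minDegree_le_degree _
      have h5 : (3 : ℝ) ≤ G.minDegree := by exact_mod_cast hδ
      nlinarith
    · have : Cᶜ = {a.snd} := by
        have hm : a.snd ∈ Cᶜ := mem_compl.mpr ha.2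
        exact eq_singleton_iff_unique_mem.mpr
          ⟨hm, fun w hw => card_le_one.mp (by omega) w hw _ hm⟩
      have h1 := card_dart_leaving_singleton (G := G) a.snd
      rw [← this] at h1
      rw [card_dart_leaving_compl] at h1
      have := hdeg a.snd
      omega
  · have : C = {a.fst} :=
      eq_singleton_iff_unique_mem.mpr
        ⟨ha.1, fun w hw => card_le_one.mp (by omega) w hw _ ha.1⟩
    have h1 := card_dart_leaving_singleton (G := G) a.fst
    rw [← this] at h1
    have := hdeg a.fst
    omega

end SimpleGraph

namespace SimpleGraph

/-! ### Perfect matchings of the gadget graph -/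

variable {V : Type*} (G : SimpleGraph V)

/-- The parity gadget graph. The ports at a vertex of `G` form a clique, both extra vertices are
joined to all of them but not to each other, and the two ports of an edge of `G` are joined.
A perfect matching leaves, at each vertex, an even number of at least two ports that are not matched
along their edges: the extra vertices use up two of them, and the others are matched in pairs. -/
def parityGadget : SimpleGraph G.GadgetVertex where
  Adj w w' := (w ≠ w' ∧ w.base = w'.base ∧ (w.isLeft ∨ w'.isLeft)) ∨
    ∃ a : G.Dart, w = .inl a ∧ w' = .inl a.symm
  symm := ⟨fun w w' h => h.imp (fun h => ⟨h.1.symm, h.2.1.symm, h.2.2.symm⟩)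
    (fun ⟨a, h, h'⟩ => ⟨a.symm, h', by rw [h, a.symm_symm]⟩)⟩
  loopless := ⟨fun w h => h.elim (fun h => h.1 rfl) fun ⟨a, h, h'⟩ =>
    a.symm_ne (Sum.inl_injective (h'.symm.trans h))⟩

variable {G} [Fintype V] [DecidableEq V] [DecidableRel G.Adj]

theorem not_isTutteViolator_parityGadget (hdeg : ∀ v, 3 ≤ G.degree v)
    (hcut : G.NoSingleEdgeCut) (u : Set G.GadgetVertex) :
    ¬ G.parityGadget.IsTutteViolator u := by
  classical
  rw [IsTutteViolator, not_lt]
  set K := ((⊤ : G.parityGadget.Subgraph).deleteVerts u).coe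
  let node (w : G.GadgetVertex) (hw : w ∉ u) :
      ((⊤ : G.parityGadget.Subgraph).deleteVerts u).verts := ⟨w, trivial, hw⟩
  have hKadj (w w' : G.GadgetVertex) (hw : w ∉ u) (hw' : w' ∉ u)
      (h : G.parityGadget.Adj w w') :
      K.connectedComponentMk (node w hw) = K.connectedComponentMk (node w' hw') := by
    refine ConnectedComponent.sound (Adj.reachable ?_)
    simpa [K, node, hw, hw'] using h
  -- The surviving ports at a vertex form a clique, so they lie in one component.
  let f (v : V) : Option K.ConnectedComponent :=
    if h : ∃ a : G.Dart, a.fst = v ∧ Sum.inl a ∉ u then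
      some (K.connectedComponentMk (node (.inl h.choose) h.choose_spec.2))
    else none
  have hf (w : G.GadgetVertex) (hw : w ∉ u) (hne : f w.base ≠ none) :
      f w.base = some (K.connectedComponentMk (node w hw)) := by
    by_cases h : ∃ a : G.Dart, a.fst = w.base ∧ Sum.inl a ∉ u
    · simp only [f, dif_pos h]
      congr 1
      by_cases heq : (Sum.inl h.choose : G.GadgetVertex) = w
      · simp only [heq]
      · exact hKadj _ _ h.choose_spec.2 hw (Or.inl ⟨heq, h.choose_spec.1, Or.inl rfl⟩)
    · exact absurd (dif_neg h) hne
  have hport (a : G.Dart) (ha : Sum.inl a ∉ u) : f a.fst ≠ none := by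
    have h : ∃ b : G.Dart, b.fst = a.fst ∧ Sum.inl b ∉ u := ⟨a, rfl, ha⟩
    simp [f, dif_pos h]
  let O : Finset K.ConnectedComponent := K.oddComponents.toFinset
  let P (c : K.ConnectedComponent) : Prop := ∃ p : V × Bool, f p.1 = none ∧
    ∃ hp : Sum.inr p ∉ u, K.connectedComponentMk (node (.inr p) hp) = c
  have hO : #O ≤ 2 * #{v | f v = none} + #({c ∈ O | ¬ P c}.image some) := by
    rw [← card_filter_add_card_filter_not (s := O) P,
      card_image_of_injective _ (Option.some_injective _)]
    refine Nat.add_le_add_right ?_ _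
    have h2 : 2 * #{v | f v = none} = #(({v | f v = none} : Finset V) ×ˢ (univ : Finset Bool)) := by
      rw [card_product, mul_comm]; rfl
    rw [h2]
    refine card_le_card_of_forall_subsingleton
      (fun c p => ∃ hp : Sum.inr p ∉ u, K.connectedComponentMk (node (.inr p) hp) = c) ?_ ?_
    · intro c hc
      obtain ⟨p, hp, h⟩ := (mem_filter.mp hc).2
      exact ⟨p, by simpa using hp, h⟩
    · rintro p - c ⟨-, _, rfl⟩ c' ⟨-, _, rfl⟩
      rfl
  have hcount := two_mul_card_add_card_le hdeg hcut u.toFinset f ({c ∈ O | ¬ P c}.image some)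
    (by simp) ?_ ?_ ?_
  · rw [Set.ncard_eq_toFinset_card', Set.ncard_eq_toFinset_card']
    exact hO.trans hcount
  · intro a ha
    by_contra h
    exact hport a (by simpa using h) ha
  · intro a ha hb
    rw [Set.mem_toFinset] at ha hb
    have h1 := hf _ ha (hport a ha)
    have h2 := hf _ hb (hport a.symm hb)
    rw [hKadj _ _ ha hb (Or.inr ⟨a, rfl, rfl⟩)] at h1
    exact h1.trans h2.symm
  · intro c' hc'
    obtain ⟨c, hc, rfl⟩ := mem_image.mp hc'
    rw [mem_filter] at hc
    obtain ⟨hcO, hcP⟩ := hc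
    have hodd : Odd c.supp.ncard := by simpa [O] using hcO
    rw [← Set.ncard_image_of_injective _ Subtype.val_injective] at hodd
    convert hodd
    rw [← Set.ncard_coe_finset]
    congr 1
    ext w
    simp only [Set.mem_toFinset, coe_filter, mem_univ, true_and, Set.mem_ofPred_eq, Set.mem_image,
      ConnectedComponent.mem_supp_iff]
    constructor
    · rintro ⟨hw, h⟩
      refine ⟨node w hw, ?_, rfl⟩
      exact Option.some_injective _ ((hf w hw (by simp [h])).symm.trans h)
    · rintro ⟨⟨w, hw⟩, hwc, rfl⟩
      refine ⟨hw.2, ?_⟩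
      rw [hf w hw.2 ?_]
      · exact congrArg some hwc
      · rcases w with a | p
        · exact hport a hw.2
        · exact fun h => hcP ⟨p, h, hw.2, hwc⟩

/-- The edges whose two ports are not matched to each other form an even spanning subgraph. -/
theorem exists_isEvenGraph_of_isPerfectMatching {M : G.parityGadget.Subgraph}
    (hM : M.IsPerfectMatching) :
    ∃ (H : SimpleGraph V) (_ : DecidableRel H.Adj), H ≤ G ∧ IsEvenGraph H := by
  classical
  rw [Subgraph.isPerfectMatching_iff] at hM
  choose m hm huniq using hM
  have hmm (w : G.GadgetVertex) : m (m w) = w := (huniq _ _ (hm w).symm).symm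
  let H : SimpleGraph V :=
    { Adj := fun v w => ∃ a : G.Dart, a.fst = v ∧ a.snd = w ∧ m (.inl a) ≠ .inl a.symm
      symm := ⟨fun v w ⟨a, h1, h2, h3⟩ => ⟨a.symm, h2, h1, fun h => h3 (by
        rw [a.symm_symm] at h
        rw [← h, hmm])⟩⟩
      loopless := ⟨fun v ⟨a, h1, h2, _⟩ => a.adj.ne (h1.trans h2.symm)⟩ }
  refine ⟨H, inferInstance, ?_, fun v => ?_⟩
  · rintro _ _ ⟨a, rfl, rfl, -⟩
    exact a.adj
  have hdeg (i : Fintype (H.neighborSet v)) : @degree V H v i =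
        #{a : G.Dart | a.fst = v ∧ m (.inl a) ≠ .inl a.symm} := by
    rw [← card_neighborFinset_eq_degree]
    symm
    refine card_bij (fun a _ => a.snd) ?_ ?_ ?_
    · intro a ha
      rw [mem_filter_univ] at ha
      exact (mem_neighborFinset _ _ _).mpr ⟨a, ha.1, rfl, ha.2⟩
    · intro a ha b hb h
      rw [mem_filter_univ] at ha hb
      exact Dart.ext _ _ (Prod.ext (ha.1.trans hb.1.symm) h)
    · intro w hw
      obtain ⟨a, h1, h2, h3⟩ := (mem_neighborFinset _ _ _).mp hw
      exact ⟨a, by simp [h1, h3], h2⟩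
  rw [hdeg]
  constructor
  · rw [card_pos]
    rcases (hm (.inr (v, true))).adj_sub with ⟨-, h1, h2⟩ | ⟨a, h, -⟩
    · rcases h3 : m (.inr (v, true)) with a | p
      · refine ⟨a, ?_⟩
        rw [h3] at h1
        have h4 : m (.inl a) = .inr (v, true) := by rw [← h3, hmm]
        rw [mem_filter_univ, h4]
        exact ⟨h1.symm, Sum.inr_ne_inl⟩
      · simp [h3] at h2
    · exact absurd h Sum.inr_ne_inl
  · -- The gadget vertices at `v` not matched along an edge of `G` are matched among themselves.
    have heven : Even #{w : G.GadgetVertex |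
        w.base = v ∧ ∀ a : G.Dart, w = .inl a → m w ≠ .inl a.symm} := by
      refine even_card_of_involution _ m ?_ (fun w _ => (hm w).ne.symm) fun w _ => hmm w
      intro w
      simp only [mem_filter_univ]
      rintro ⟨rfl, h⟩
      rcases (hm w).adj_sub with ⟨-, h1, -⟩ | ⟨a, h1, h2⟩
      · refine ⟨h1.symm, fun a ha h2 => h a.symm ?_ ?_⟩
        · rw [← hmm w, h2]
        · rw [ha, a.symm_symm]
      · exact absurd h2 (h a h1)
    have hcard : #{w : G.GadgetVertex |
        w.base = v ∧ ∀ a : G.Dart, w = .inl a → m w ≠ .inl a.symm} =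
        #{a : G.Dart | a.fst = v ∧ m (.inl a) ≠ .inl a.symm} + 2 := by
      simp only [card_filter, Fintype.sum_sum_type, Fintype.sum_prod_type, Fintype.sum_bool,
        GadgetVertex.base_inl, GadgetVertex.base_inr, Sum.inl.injEq, forall_eq', reduceCtorEq,
        IsEmpty.forall_iff, implies_true, and_true, sum_add_distrib, sum_ite_eq', mem_univ,
        if_true]
    rw [hcard] at heven
    simpa [Nat.even_add] using heven

end SimpleGraph

theorem theorem4p1 {V : Type*} [Fintype V] [DecidableEq V]
    (G : SimpleGraph V) [DecidableRel G.Adj]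
    (hδ : 3 ≤ G.minDegree)
    (hμ : ((G.minDegree : ℝ) - 1) * laplacianEigenvalue G 2 ≥
      laplacianEigenvalue G (Fintype.card V)) :
    ∃ (H : SimpleGraph V) (_ : DecidableRel H.Adj), H ≤ G ∧ IsEvenGraph H := by
  obtain ⟨M, hM⟩ := SimpleGraph.tutte.mpr
    (SimpleGraph.not_isTutteViolator_parityGadget
      (fun v => hδ.trans (G.minDegree_le_degree v))
      (SimpleGraph.noSingleEdgeCut_of_laplacianEigenvalue hδ hμ))
  exact SimpleGraph.exists_isEvenGraph_of_isPerfectMatching hM
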